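/- \textbf{Lemma (Winner consensus feasibility).} Let $n=5f+1$ players be given, of which $t$ are Byzantine and $k$ are rational; these $C=k+t$ players form the coalition, which may deviate arbitrarily and in a coordinated way, and all other players are correct. \emph{Finalization phase.} The players run the commit-reveal phase BFTCR with quorum $4f+1$: each player reliably broadcasts one signed, encrypted commitment to the hash of its predecided value, or to its proofs of fraud if it holds some; after delivering $4f+1$ commitments it broadcasts the list of them; after delivering $4f+1$ lists it reveals its decryption key; it decides a value $v$ once $4f+1$ delivered commitments have been opened to the hash of $v$, and it returns when valid proofs of fraud are opened. Messages may be delayed and withheld arbitrarily. Coalition members may sign and send anything, in particular different commitments to different players; signatures of correct players cannot be forged. The execution \emph{forks into $a$ branches} if the correct players decide exactly $a$ different values in this way. A player is a \emph{detected equivocator} if correct players have delivered two different commitments signed by it. \emph{Consensus.} A protocol solves consensus for a set of players with given faulty (arbitrarily behaving) members if, whenever all correct players have valid inputs (for a given validity predicate on an arbitrary set of values): no two values are ever output by correct players; every value output by a correct player is valid and equals the common input of the correct players if they have one; and under partial synchrony every correct player eventually outputs a value. Here a scheduler chooses at each time which player moves and which messages in transit to it are delivered; every correct player moves infinitely often;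 channels are pairwise and authenticated; and partial synchrony means that for some finite $\mathrm{GST}$ and $\Delta$, unknown to the protocol, every message sent at time $s$ between correct players is delivered by time $\max(s,\mathrm{GST})+\Delta$. \emph{Claim.} There is a winner consensus protocol, given for every set $E$ of excluded players as a protocol among the residual players (those not in $E$) and depending only on $f$, $E$ and the validity predicate, such that the following holds for every execution of BFTCR that forks into $a\ge 2$ branches. At least $3f+1$ equivocators are detected, and all of them belong to the coalition. If a set $E$ of at least $3f+1$ detected equivocators is excluded (leaving $n'=2f$ residual players if $|E|=3f+1$), and if \[ C\le\left\lfloor\frac{11f+2}{3}\right\rfloor\qquad\text{and}\qquad t<\frac{2f}{3}, \] then the number of coalition members among the $n'=n-|E|$ residual players is less than $n'/3$, and the winner consensus among the residual players solves consensus, with all residual coalition members regarded as faulty. -/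

import Mathlib

universe u v

namespace Snare

/-! ### The commit-reveal finalization phase (BFTCR) on `5f+1` players, quorum `4f+1` -/

/-- The `n = 5f+1` players. -/
abbrev Player (f : ℕ) : Type := Fin (5 * f + 1)

/-- The quorum `h = 4f+1`. -/
abbrev quorum (f : ℕ) : ℕ := 4 * f + 1

/-- What a player can commit to: the hash of its predecided value (hashing is collision free, so
the hash is represented by the value) or a bundle of proofs of fraud, represented by the set of
players it accuses. -/
inductive Payload (f : ℕ) (V : Type*) where
  | hash (v : V) : Payload f V
  | pofs (B : Finset (Player f)) : Payload f V

/-- An (ideal) ciphertext: it opens, with the key it was made for, to its payload. -/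
structure Cipher (f : ℕ) (V : Type*) where
  key : ℕ
  payload : Payload f V

/-- Decryption. -/
def Cipher.dec {f : ℕ} {V : Type*} (c : Cipher f V) (k : ℕ) : Option (Payload f V) :=
  if c.key = k then some c.payload else none

/-- The message contents of the phase: first reliable broadcast (encrypted commitment), second
reliable broadcast (list of delivered commitments), reveal of a decryption key. -/
inductive Msg (f : ℕ) (V : Type*) where
  | rb1 (c : Cipher f V) : Msg f V
  | rb2 (L : Player f → Option (Cipher f V)) : Msg f V
  | key (k : ℕ) : Msg f V

/-- The situation in which the phase starts: who is Byzantine, who is rational (these two sets form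
the coalition, all others are correct), the predecisions, the decryption key of every player, the
players whose conduct in the predecision layer can be proved fraudulent (correct players never are,
signatures being unforgeable), and the proofs of fraud that each player holds. -/
structure Setup (f : ℕ) (V : Type*) where
  byz : Finset (Player f)
  rational : Finset (Player f)
  disj : Disjoint byz rational
  predecision : Player f → V
  ownKey : Player f → ℕ
  fraud : Finset (Player f)
  fraud_sub : fraud ⊆ byz ∪ rational
  pofs : Player f → Finset (Player f)
  pofs_sub : ∀ i, pofs i ⊆ fraud

namespace Setup

variable {f : ℕ} {V : Type*}

/-- The coalition: all Byzantine and all rational players. -/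
def coalition (S : Setup f V) : Finset (Player f) := S.byz ∪ S.rational

/-- Verification of a bundle of proofs of fraud. -/
def Verify (S : Setup f V) (B : Finset (Player f)) : Prop := B.Nonempty ∧ B ⊆ S.fraud

open Classical in
/-- The commitment of a player that follows the protocol: its proofs of fraud if it has some, and
otherwise the hash of its predecision, encrypted under its key. -/
noncomputable def ownCommit (S : Setup f V) (i : Player f) : Cipher f V :=
  ⟨S.ownKey i, if (S.pofs i).Nonempty then .pofs (S.pofs i) else .hash (S.predecision i)⟩

end Setup

/-- The local state of a player in the phase. -/
structure Local (f : ℕ) (V : Type*) where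
  rb1 : Player f → Option (Cipher f V)
  rb2 : Player f → Option (Player f → Option (Cipher f V))
  keys : Player f → Option ℕ
  /-- the player has started its second reliable broadcast -/
  listed : Prop
  /-- the value that the player decided on a quorum of matching hashes -/
  decided : Option V
  /-- the player has received valid proofs of fraud and has returned them -/
  returned : Prop

/-- The content of the commitment of `j`, once it and the key of `j` have been delivered. -/
def Local.opened {f : ℕ} {V : Type*} (l : Local f V) (j : Player f) : Option (Payload f V) :=
  (l.rb1 j).bind fun c => (l.keys j).bind fun k => c.dec k

/-- A global state: all signed messages sent so far, each with its signer, and the local states. -/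
structure State (f : ℕ) (V : Type*) where
  net : Set (Player f × Msg f V)
  loc : Player f → Local f V

/-- Nothing sent, nothing delivered. -/
def State.init (f : ℕ) (V : Type*) : State f V where
  net := ∅
  loc := fun _ => ⟨fun _ => none, fun _ => none, fun _ => none, False, none, False⟩

/-- Add a message to the network. -/
def State.send {f : ℕ} {V : Type*} (s : State f V) (i : Player f) (m : Msg f V) : State f V :=
  { s with net := insert (i, m) s.net }

/-- Replace the local state of `i`. -/
def State.setLoc {f : ℕ} {V : Type*} (s : State f V) (i : Player f) (l : Local f V) : State f V :=
  { s with loc := Function.update s.loc i l }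

/-- The moves of the phase. Correct players follow the protocol; a member of the coalition may sign
and send anything at any time, in particular different commitments to different players, so that
a reliable broadcast is only reliable for a correct sender. Nothing can be sent in the name of a
correct player. Messages may be delayed, reordered and withheld arbitrarily. -/
inductive Step {f : ℕ} {V : Type*} (S : Setup f V) : State f V → State f V → Prop
  /-- start the first reliable broadcast -/
  | commit (s : State f V) (i : Player f) (hi : i ∉ S.coalition) :
      Step S s (s.send i (.rb1 (S.ownCommit i)))
  /-- deliver a commitment -/
  | deliverRb1 (s : State f V) (i j : Player f) (c : Cipher f V) (hi : i ∉ S.coalition)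
      (hm : (j, Msg.rb1 c) ∈ s.net) (hnew : (s.loc i).rb1 j = none) :
      Step S s (s.setLoc i
        { s.loc i with rb1 := Function.update (s.loc i).rb1 j (some c) })
  /-- start the second reliable broadcast once a quorum of commitments is delivered -/
  | list (s : State f V) (i : Player f) (hi : i ∉ S.coalition)
      (h1 : quorum f ≤ {j | (s.loc i).rb1 j ≠ none}.ncard) (hnew : ¬ (s.loc i).listed) :
      Step S s ((s.send i (.rb2 (s.loc i).rb1)).setLoc i { s.loc i with listed := True })
  /-- deliver a list -/
  | deliverRb2 (s : State f V) (i j : Player f) (L : Player f → Option (Cipher f V))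
      (hi : i ∉ S.coalition) (hm : (j, Msg.rb2 L) ∈ s.net) (hnew : (s.loc i).rb2 j = none) :
      Step S s (s.setLoc i
        { s.loc i with rb2 := Function.update (s.loc i).rb2 j (some L) })
  /-- reveal the decryption key once quorums of commitments and lists are delivered -/
  | reveal (s : State f V) (i : Player f) (hi : i ∉ S.coalition)
      (h1 : quorum f ≤ {j | (s.loc i).rb1 j ≠ none}.ncard)
      (h2 : quorum f ≤ {j | (s.loc i).rb2 j ≠ none}.ncard) :
      Step S s (s.send i (.key (S.ownKey i)))
  /-- deliver a key, after both broadcasts of its owner -/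
  | deliverKey (s : State f V) (i j : Player f) (k : ℕ) (hi : i ∉ S.coalition)
      (hm : (j, Msg.key k) ∈ s.net) (h1 : (s.loc i).rb1 j ≠ none) (h2 : (s.loc i).rb2 j ≠ none)
      (hnew : (s.loc i).keys j = none) :
      Step S s (s.setLoc i
        { s.loc i with keys := Function.update (s.loc i).keys j (some k) })
  /-- decide a value on a quorum of matching revealed hashes -/
  | decide (s : State f V) (i : Player f) (v : V) (hi : i ∉ S.coalition)
      (hq : quorum f ≤ {j | (s.loc i).opened j = some (.hash v)}.ncard)
      (hnew : (s.loc i).decided = none) (hret : ¬ (s.loc i).returned) :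
      Step S s (s.setLoc i { s.loc i with decided := some v })
  /-- return on revealed valid proofs of fraud -/
  | ret (s : State f V) (i j : Player f) (B : Finset (Player f)) (hi : i ∉ S.coalition)
      (hB : (s.loc i).opened j = some (.pofs B)) (hv : S.Verify B) :
      Step S s (s.setLoc i { s.loc i with returned := True })
  /-- arbitrary message of a coalition member -/
  | corrupt (s : State f V) (j : Player f) (m : Msg f V) (hj : j ∈ S.coalition) :
      Step S s (s.send j m)

/-- The states that an execution of the phase can reach. -/
def Reachable {f : ℕ} {V : Type*} (S : Setup f V) (s : State f V) : Prop :=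
  Relation.ReflTransGen (Step S) (State.init f V) s

/-- The branches of an execution: the values decided by correct players on a quorum. -/
def branches {f : ℕ} {V : Type*} (S : Setup f V) (s : State f V) : Set V :=
  {v | ∃ i, i ∉ S.coalition ∧ (s.loc i).decided = some v}

open Classical in
/-- The detected equivocators: the players of whom correct players hold two different signed
commitments of the (single) first reliable broadcast. -/
noncomputable def detected {f : ℕ} {V : Type*} (S : Setup f V) (s : State f V) :
    Finset (Player f) :=
  {j | ∃ i i' c c', i ∉ S.coalition ∧ i' ∉ S.coalition ∧
    (s.loc i).rb1 j = some c ∧ (s.loc i').rb1 j = some c' ∧ c ≠ c'}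

/-! ### Consensus under partial synchrony -/

/-- A deterministic message passing protocol for the players `P` with inputs and outputs in `α`.
When a player moves, it receives a set of messages, each with its sender (channels are pairwise
and authenticated), changes its state, and sends at most one message to each player. The protocol
knows neither the stabilization time nor the delay bound, and has no clock. -/
structure Protocol (P : Type) (α : Type u) where
  LState : Type u
  Message : Type u
  init : P → α → LState
  step : P → LState → Set (P × Message) → LState × (P → Option Message)
  output : LState → Option α

/-- The runs of a protocol with faulty players `F`. At every time the scheduler chooses the player
that moves, and a set of messages in transit to it that are delivered just before the move. The
message that was sent at time `s` to a player is referred to by the number `s`. Faulty players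
send arbitrary messages when they move. Every correct player moves infinitely often. -/
structure Run {P : Type} {α : Type u} (W : Protocol P α) (F : Set P) (input : P → α) where
  mover : ℕ → P
  delivered : ℕ → Set ℕ
  sent : ℕ → P → Option W.Message
  state : ℕ → P → W.LState
  in_transit : ∀ τ, ∀ s ∈ delivered τ, s < τ ∧ sent s (mover τ) ≠ none ∧
    ∀ τ' < τ, mover τ' = mover τ → s ∉ delivered τ'
  state_zero : ∀ i ∉ F, state 0 i = W.init i (input i)
  state_idle : ∀ τ, ∀ i ∉ F, i ≠ mover τ → state (τ + 1) i = state τ i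
  move : ∀ τ, mover τ ∉ F →
    (state (τ + 1) (mover τ), sent τ) = W.step (mover τ) (state τ (mover τ))
      {x | ∃ s ∈ delivered τ, x.1 = mover s ∧ sent s (mover τ) = some x.2}
  fair : ∀ i ∉ F, ∀ τ, ∃ τ' ≥ τ, mover τ' = i

/-- Partial synchrony with stabilization time `GST` and delay bound `Δ`: a message between correct
players is delivered at most `Δ` after it was sent or after `GST`, whichever is later. -/
def Run.PartiallySynchronous {P : Type} {α : Type u} {W : Protocol P α} {F : Set P}
    {input : P → α} (r : Run W F input) (GST Δ : ℕ) : Prop :=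
  ∀ s j, r.mover s ∉ F → j ∉ F → r.sent s j ≠ none →
    ∃ τ ≤ max s GST + Δ, r.mover τ = j ∧ s ∈ r.delivered τ

/-- Player `i` has output `v` at time `τ`. -/
def Run.Decides {P : Type} {α : Type u} {W : Protocol P α} {F : Set P} {input : P → α}
    (r : Run W F input) (i : P) (τ : ℕ) (v : α) : Prop :=
  W.output (r.state τ i) = some v

/-- `W` solves consensus in the presence of the faulty players `F`, whose behaviour is arbitrary,
if whenever the correct players have valid inputs:
* (agreement) no two values are ever output by correct players;
* (validity) every value output by a correct player is valid, and it is the common input of the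
  correct players if they have a common input;
* (termination) under partial synchrony every correct player eventually has an output. -/
def SolvesConsensus {P : Type} {α : Type u} (W : Protocol P α) (valid : α → Prop) (F : Set P) :
    Prop :=
  ∀ input : P → α, (∀ i ∉ F, valid (input i)) → ∀ r : Run W F input,
    (∀ i ∉ F, ∀ j ∉ F, ∀ τ τ' v w, r.Decides i τ v → r.Decides j τ' w → v = w) ∧
    (∀ i ∉ F, ∀ τ v, r.Decides i τ v →
      valid v ∧ ∀ x, (∀ j ∉ F, input j = x) → v = x) ∧
    (∀ GST Δ, r.PartiallySynchronous GST Δ → ∀ i ∉ F, ∃ τ v, r.Decides i τ v)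

/-- The players that remain after the exclusion of `E`. -/
abbrev Residual {f : ℕ} (E : Finset (Player f)) : Type := {p : Player f // p ∉ E}

end Snare

/-! A decision rests on `4f + 1` commitments opened to one hash, so two branches give two quorums
sharing at least `2(4f + 1) - (5f + 1) = 3f + 1` players. A ciphertext has a single payload, so each
shared player signed two different commitments (`Reachable.card_detected`). A correct player signs
only one, so every equivocator is in the coalition. Excluding `E` shrinks coalition and player set
alike: `3(C - |E|) < 5f + 1 - |E|` says `3C < 5f + 1 + 2|E|`, whose right side is at least `11f +
3`.

What remains is consensus with less than a third of the players faulty, without signatures, clocks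
or known delays. The algorithm is written in communication-closed rounds. It is safe because quorums
of more than two thirds meet in a correct player, and a committed player votes for another value
only on a certificate at least as new (`cert_eq_of_quorum_commits`). It terminates because
certificates spread to all correct players (`cert_relay`), so a correct leader eventually knows
every certificate that binds a correct voter (`exists_common_vote`).

Rounds are simulated by counting local moves. Their lengths grow factorially and so eventually
exceed any fixed multiple of the preceding ones, which absorbs the unknown delay and the different
speeds of the players (`Run.exists_rounds`). -/

namespace Snare

/-! ### Forks of the finalization phase: quorum intersection yields equivocators. -/

section Fork

variable {f : ℕ} {V : Type*} {S : Setup f V} {s : State f V}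

/-- In a reachable state, every commitment signed or delivered in the name of a correct player is
its own one. -/
theorem Reachable.rb1_eq_ownCommit (h : Reachable S s) :
    (∀ j c, j ∉ S.coalition → (j, Msg.rb1 c) ∈ s.net → c = S.ownCommit j) ∧
    ∀ i j c, j ∉ S.coalition → (s.loc i).rb1 j = some c → c = S.ownCommit j := by
  induction h with
  | refl => simp [State.init]
  | tail _ hstep ih =>
    obtain ⟨ih₁, ih₂⟩ := ih
    cases hstep with
    | deliverRb1 i j c hi hm hnew =>
      refine ⟨ih₁, fun i' j' c' hj' hc' => ?_⟩
      simp only [State.setLoc, Function.update_apply] at hc'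
      split_ifs at hc' with hii
      · simp only [Function.update_apply] at hc'
        split_ifs at hc' with hjj <;> grind
      · exact ih₂ _ _ _ hj' hc'
    | _ =>
      refine ⟨fun j' c' hj' hc' => ?_, fun i' j' c' hj' hc' => ?_⟩
      · simp only [State.send, State.setLoc, Set.mem_insert_iff, Prod.mk.injEq, Msg.rb1.injEq,
          reduceCtorEq, and_false, false_or] at hc'
        grind
      · simp only [State.send, State.setLoc, Function.update_apply] at hc'
        (try split_ifs at hc') <;> grind

/-- An opened commitment stays opened in every later state. -/
theorem Step.opened_mono {s' : State f V} (h : Step S s s') (i j : Player f) (p : Payload f V)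
    (ho : (s.loc i).opened j = some p) : (s'.loc i).opened j = some p := by
  simp only [Local.opened, Option.bind_eq_some_iff] at ho ⊢
  obtain ⟨c, hc, k, hk, hp⟩ := ho
  refine ⟨c, ?_, k, ?_, hp⟩ <;> cases h <;>
    simp only [State.send, State.setLoc, Function.update_apply] <;> (try split_ifs) <;>
    simp_all [Function.update_apply] <;> grind

/-- A decided value has been opened by a quorum. -/
theorem Reachable.quorum_of_decided (h : Reachable S s) (i : Player f) (v : V)
    (hv : (s.loc i).decided = some v) :
    quorum f ≤ {j | (s.loc i).opened j = some (.hash v)}.ncard := by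
  induction h with
  | refl => simp [State.init] at hv
  | @tail s s' _ hstep ih =>
    have key (h : quorum f ≤ {j | (s.loc i).opened j = some (.hash v)}.ncard) :
        quorum f ≤ {j | (s'.loc i).opened j = some (.hash v)}.ncard :=
      h.trans (Set.ncard_le_ncard fun j hj => hstep.opened_mono i j _ hj)
    apply key
    cases hstep with
    | decide i' w hi hq hnew hret =>
      simp only [State.setLoc, Function.update_apply] at hv
      split_ifs at hv with h
      · subst h
        simp only [Option.some.injEq] at hv
        exact hv ▸ hq
      · exact ih hv
    | _ =>
      apply ih
      simp only [State.send, State.setLoc, Function.update_apply] at hv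
      (try split_ifs at hv) <;> simp_all

theorem Reachable.detected_subset_coalition (h : Reachable S s) :
    detected S s ⊆ S.coalition := by
  intro j hj
  simp only [detected, Finset.mem_filter, Finset.mem_univ, true_and] at hj
  obtain ⟨i, i', c, c', -, -, hc, hc', hne⟩ := hj
  by_contra hjc
  exact hne ((h.rb1_eq_ownCommit.2 _ _ _ hjc hc).trans (h.rb1_eq_ownCommit.2 _ _ _ hjc hc').symm)

theorem Reachable.card_detected (h : Reachable S s) (ha : 2 ≤ (branches S s).ncard) :
    3 * f + 1 ≤ (detected S s).card := by
  -- An infinite set would have `ncard` equal to `0`, so finiteness comes with the bound.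
  obtain ⟨v, ⟨i, hi, hv⟩, w, ⟨i', hi', hw⟩, hvw⟩ :=
    (Set.one_lt_ncard (Set.finite_of_ncard_pos (by omega))).1 ha
  have hA := h.quorum_of_decided i v hv
  have hB := h.quorum_of_decided i' w hw
  set A := {j | (s.loc i).opened j = some (.hash v)}
  set B := {j | (s.loc i').opened j = some (.hash w)}
  have hsub : A ∩ B ⊆ (detected S s : Set (Player f)) := by
    rintro j ⟨hjA, hjB⟩
    simp only [A, B, Set.mem_ofPred_eq, Local.opened, Option.bind_eq_some_iff] at hjA hjB
    obtain ⟨c, hc, k, -, hp⟩ := hjA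
    obtain ⟨c', hc', k', -, hp'⟩ := hjB
    simp only [detected, Finset.coe_filter, Finset.mem_univ, true_and, Set.mem_ofPred_eq]
    refine ⟨i, i', c, c', hi, hi', hc, hc', ?_⟩
    -- The keys used by the two players do not matter: one ciphertext cannot open to two hashes.
    rintro rfl
    simp only [Cipher.dec, Option.ite_none_right_eq_some, Option.some.injEq] at hp hp'
    have := hp.2.symm.trans hp'.2
    simp_all
  have h1 := Set.ncard_le_ncard hsub
  have h2 := Set.ncard_union_add_ncard_inter A B
  have h3 : (A ∪ B).ncard ≤ 5 * f + 1 := by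
    simpa using Set.ncard_le_ncard (Set.subset_univ (A ∪ B))
  rw [Set.ncard_coe_finset] at h1
  simp only [quorum] at hA hB
  omega

end Fork

/-! ### Counting the residual players. -/

theorem card_residual {f : ℕ} (E : Finset (Player f)) :
    Fintype.card (Residual E) = 5 * f + 1 - E.card := by
  rw [Fintype.card_subtype_compl]; simp

/-- Excluding enough coalition members leaves fewer than a third of them. -/
theorem three_mul_card_sdiff_lt {f : ℕ} {C E : Finset (Player f)} (hE : E ⊆ C)
    (hcard : 3 * f + 1 ≤ E.card) (hC : C.card ≤ (11 * f + 2) / 3) :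
    3 * (C \ E).card < Fintype.card (Residual E) := by
  have h1 := card_residual E
  have h2 := Finset.card_sdiff_add_card_eq_card hE
  -- This keeps the subtraction in `card_residual` from truncating.
  have h3 : C.card ≤ 5 * f + 1 := by simpa using Finset.card_le_univ C
  omega

/-! ### Simulation of communication-closed rounds -/

/-- A deterministic algorithm in communication-closed rounds: in every round each player sends its
state to all and computes its next state from the number of the round and the states received. -/
structure RoundAlgorithm (P : Type) (α : Type u) where
  State : Type u
  init : α → State
  next : ℕ → State → (P → Option State) → State
  output : State → Option α

/-- The rounds of an execution with faulty players `F`: `x q i` is the state of `i` at the start of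
round `q`, and `rcv q i j` is what `i` received from `j` in round `q`. Messages may be lost. -/
structure RoundAlgorithm.IsExecution {P : Type} {α : Type u} (A : RoundAlgorithm P α) (F : Set P)
    (input : P → α) (x : ℕ → P → A.State) (rcv : ℕ → P → P → Option A.State) : Prop where
  zero : ∀ i ∉ F, x 0 i = A.init (input i)
  succ : ∀ q, ∀ i ∉ F, x (q + 1) i = A.next q (x q i) (rcv q i)
  authentic : ∀ q, ∀ i ∉ F, ∀ j ∉ F, ∀ m, rcv q i j = some m → m = x q j

/-- The local state of the simulation of a round algorithm: the number of moves made, the current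
round, all messages ever received, and the state of the algorithm in the current round. -/
structure Sim (P : Type) (C : Type u) : Type u where
  count : ℕ
  round : ℕ
  inbox : Set (P × (ℕ × C))
  core : C

open Classical in
/-- The message for round `q` that an inbox holds from each player. -/
noncomputable def roundMessages {P : Type} {C : Type u} (inbox : Set (P × (ℕ × C))) (q : ℕ)
    (j : P) : Option C :=
  if h : ∃ m, (j, (q, m)) ∈ inbox then some h.choose else none

/-- One move of the simulation. Round `q` is left when `(q + 2)!` moves have been made. -/
noncomputable def RoundAlgorithm.simStep {P : Type} {α : Type u} (A : RoundAlgorithm P α)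
    (l : Sim P A.State) (M : Set (P × (ℕ × A.State))) : Sim P A.State :=
  if (l.round + 2).factorial ≤ l.count + 1 then
    ⟨l.count + 1, l.round + 1, l.inbox ∪ M,
      A.next l.round l.core (roundMessages (l.inbox ∪ M) l.round)⟩
  else ⟨l.count + 1, l.round, l.inbox ∪ M, l.core⟩

/-- The protocol that simulates a round algorithm. The local number of moves serves as a clock, and
every move sends the state in the current round to all players, the mover included. -/
noncomputable def RoundAlgorithm.toProtocol {P : Type} {α : Type u} (A : RoundAlgorithm P α) :
    Protocol P α where
  LState := Sim P A.State
  Message := ℕ × A.State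
  init _ a := ⟨0, 0, ∅, A.init a⟩
  step _ l M := (A.simStep l M, fun _ => some ((A.simStep l M).round, (A.simStep l M).core))
  output l := A.output l.core

section Simulation

variable {P : Type} {α : Type u} {A : RoundAlgorithm P α} {F : Set P} {input : P → α}

/-- The simulation state of a player in a run. -/
def Run.sim (r : Run A.toProtocol F input) (τ : ℕ) (i : P) : Sim P A.State := r.state τ i

/-- The messages that the mover receives at time `τ`. -/
def Run.receives (r : Run A.toProtocol F input) (τ : ℕ) : Set (P × (ℕ × A.State)) :=
  {x | ∃ s ∈ r.delivered τ, x.1 = r.mover s ∧ r.sent s (r.mover τ) = some x.2}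

variable (r : Run A.toProtocol F input) {i j : P}

theorem Run.sim_zero (hi : i ∉ F) : r.sim 0 i = ⟨0, 0, ∅, A.init (input i)⟩ := r.state_zero i hi

theorem Run.sim_idle {τ : ℕ} (hi : i ∉ F) (h : r.mover τ ≠ i) : r.sim (τ + 1) i = r.sim τ i :=
  r.state_idle τ i hi h.symm

theorem Run.sim_move {τ : ℕ} (hi : i ∉ F) (h : r.mover τ = i) :
    r.sim (τ + 1) i = A.simStep (r.sim τ i) (r.receives τ) := by
  subst h
  exact congrArg Prod.fst (r.move τ hi)

theorem Run.sent_eq {τ : ℕ} (hi : i ∉ F) (h : r.mover τ = i) (k : P) :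
    r.sent τ k = some ((r.sim (τ + 1) i).round, (r.sim (τ + 1) i).core) := by
  rw [r.sim_move hi h]
  subst h
  exact congrFun (congrArg Prod.snd (r.move τ hi)) k

theorem Run.sent_ne_none {τ : ℕ} (hi : i ∉ F) (h : r.mover τ = i) (k : P) :
    r.sent τ k ≠ none :=
  fun h0 => Option.some_ne_none _ ((r.sent_eq hi h k).symm.trans h0)

/-- A property of a correct player's state that holds initially and is kept by its moves. -/
theorem Run.sim_induction (hi : i ∉ F) {p : ℕ → Sim P A.State → Prop}
    (hz : p 0 ⟨0, 0, ∅, A.init (input i)⟩) (hidle : ∀ τ l, p τ l → p (τ + 1) l)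
    (hmove : ∀ τ, r.mover τ = i → p τ (r.sim τ i) →
      p (τ + 1) (A.simStep (r.sim τ i) (r.receives τ))) (τ : ℕ) : p τ (r.sim τ i) := by
  induction τ with
  | zero => rw [r.sim_zero hi]; exact hz
  | succ τ ih =>
    by_cases h : r.mover τ = i
    · rw [r.sim_move hi h]; exact hmove τ h ih
    · rw [r.sim_idle hi h]; exact hidle _ _ ih

/-- Each time step gives a player at most one move. This is what prevents fast players from leaving
a round too early. -/
theorem Run.count_le (hi : i ∉ F) (τ : ℕ) : (r.sim τ i).count ≤ τ := by
  refine r.sim_induction hi (p := fun τ l => l.count ≤ τ) le_rfl (fun _ _ h => h.trans (by simp))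
    (fun τ _ h => ?_) τ
  unfold RoundAlgorithm.simStep
  split_ifs <;> simpa using h

/-- The local clock and the round determine each other. Round `0` is exempt from the lower bound
because it is entered with no moves made. -/
theorem Run.factorial_round_le (hi : i ∉ F) (τ : ℕ) :
    (0 < (r.sim τ i).round → ((r.sim τ i).round + 1).factorial ≤ (r.sim τ i).count) ∧
      (r.sim τ i).count < ((r.sim τ i).round + 2).factorial := by
  refine r.sim_induction hi (p := fun _ l =>
      (0 < l.round → (l.round + 1).factorial ≤ l.count) ∧ l.count < (l.round + 2).factorial)
    (by simp) (fun _ _ h => h) (fun τ _ h => ?_) τ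
  unfold RoundAlgorithm.simStep
  split_ifs with hc
  · have : ((r.sim τ i).round + 2).factorial < ((r.sim τ i).round + 3).factorial :=
      (Nat.factorial_lt (by omega)).2 (by omega)
    simp only [add_assoc, Nat.reduceAdd] at *
    exact ⟨fun _ => hc, by omega⟩
  · simp only
    exact ⟨fun h0 => (h.1 h0).trans (by omega), by omega⟩

theorem Run.step_mono (hi : i ∉ F) (τ : ℕ) :
    (r.sim τ i).count ≤ (r.sim (τ + 1) i).count ∧ (r.sim τ i).inbox ⊆ (r.sim (τ + 1) i).inbox ∧
      ((r.sim (τ + 1) i).round = (r.sim τ i).round ∧ (r.sim (τ + 1) i).core = (r.sim τ i).core ∨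
        r.mover τ = i ∧ (r.sim (τ + 1) i).round = (r.sim τ i).round + 1 ∧
        (r.sim (τ + 1) i).core = A.next (r.sim τ i).round (r.sim τ i).core
          (roundMessages (r.sim (τ + 1) i).inbox (r.sim τ i).round)) := by
  by_cases h : r.mover τ = i
  · rw [r.sim_move hi h]
    unfold RoundAlgorithm.simStep
    split_ifs <;> simp [h]
  · rw [r.sim_idle hi h]
    simp

theorem Run.count_mono (hi : i ∉ F) : Monotone fun τ => (r.sim τ i).count :=
  monotone_nat_of_le_succ fun τ => (r.step_mono hi τ).1

theorem Run.inbox_mono (hi : i ∉ F) : Monotone fun τ => (r.sim τ i).inbox :=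
  monotone_nat_of_le_succ fun τ => (r.step_mono hi τ).2.1

theorem Run.round_mono (hi : i ∉ F) : Monotone fun τ => (r.sim τ i).round :=
  monotone_nat_of_le_succ fun τ => by
    rcases (r.step_mono hi τ).2.2 with h | h <;> simp [h]

/-- The core changes only together with the round number. Hence a correct player sends one state per
round, and the choice in `roundMessages` is harmless. -/
theorem Run.core_eq_of_round_eq (hi : i ∉ F) {τ τ' : ℕ}
    (h : (r.sim τ i).round = (r.sim τ' i).round) : (r.sim τ i).core = (r.sim τ' i).core := by
  wlog hle : τ ≤ τ' generalizing τ τ'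
  · exact (this h.symm (by omega)).symm
  induction τ', hle using Nat.le_induction with
  | base => rfl
  | succ τ' hle ih =>
    have h1 := r.round_mono hi hle
    have h2 := r.round_mono hi (Nat.le_succ τ')
    simp only [Nat.succ_eq_add_one] at h1 h2
    rcases (r.step_mono hi τ').2.2 with h3 | h3
    · rw [h3.2]; exact ih (by omega)
    · omega

theorem Run.round_ge_of_count (hi : i ∉ F) {τ q : ℕ} (h : (q + 1).factorial ≤ (r.sim τ i).count) :
    q ≤ (r.sim τ i).round := by
  by_contra hlt
  have h1 := (r.factorial_round_le hi τ).2
  have h2 := Nat.factorial_le (show (r.sim τ i).round + 2 ≤ q + 1 by omega)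
  omega

theorem Run.count_move {τ : ℕ} (hi : i ∉ F) (h : r.mover τ = i) :
    (r.sim (τ + 1) i).count = (r.sim τ i).count + 1 := by
  rw [r.sim_move hi h]
  unfold RoundAlgorithm.simStep
  split_ifs <;> rfl

theorem Run.exists_count_ge (hi : i ∉ F) (m : ℕ) : ∃ τ, m ≤ (r.sim τ i).count := by
  induction m with
  | zero => exact ⟨0, Nat.zero_le _⟩
  | succ m ih =>
    obtain ⟨τ, hτ⟩ := ih
    obtain ⟨τ', hle, hm⟩ := r.fair i hi τ
    have := r.count_mono hi hle
    have := r.count_move hi hm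
    exact ⟨τ' + 1, by simp only at *; omega⟩

/-- Every correct player leaves every round. -/
theorem Run.exists_advance (hi : i ∉ F) (q : ℕ) : ∃ τ, r.mover τ = i ∧ (r.sim τ i).round = q ∧
    (r.sim (τ + 1) i).round = q + 1 ∧ (r.sim (τ + 1) i).core = A.next q (r.sim τ i).core
      (roundMessages (r.sim (τ + 1) i).inbox q) := by
  classical
  have hex : ∃ τ, q + 1 ≤ (r.sim τ i).round := by
    obtain ⟨τ, hτ⟩ := r.exists_count_ge hi (q + 2).factorial
    exact ⟨τ, r.round_ge_of_count hi hτ⟩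
  -- The first time beyond round `q` is not `0`, so the move just before it leaves the round.
  obtain ⟨τ, hτ⟩ : ∃ τ, Nat.find hex = τ + 1 := by
    refine Nat.exists_eq_succ_of_ne_zero fun h0 => ?_
    have := Nat.find_spec hex
    rw [h0, r.sim_zero hi] at this
    simp at this
  have h1 := Nat.find_spec hex
  have h2 := Nat.find_min hex (m := τ) (by omega)
  rw [hτ] at h1
  rcases (r.step_mono hi τ).2.2 with h | ⟨hm, hr, hc⟩
  · omega
  · have hq : (r.sim τ i).round = q := by omega
    rw [hq] at hr hc
    exact ⟨τ, hm, hq, hr, hc⟩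

/-- Messages of correct players are authentic. -/
theorem Run.mem_inbox (hi : i ∉ F) (hj : j ∉ F) {τ q : ℕ} {m : A.State}
    (h : (j, (q, m)) ∈ (r.sim τ i).inbox) :
    ∃ s, (r.sim s j).round = q ∧ (r.sim s j).core = m := by
  revert h
  refine r.sim_induction hi (p := fun _ l => (j, (q, m)) ∈ l.inbox → _) (by simp)
    (fun _ _ h => h) (fun τ hm ih h => ?_) τ
  have hmem : (j, (q, m)) ∈ (r.sim τ i).inbox ∪ r.receives τ := by
    unfold RoundAlgorithm.simStep at h
    split_ifs at h <;> exact h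
  rcases hmem with h | ⟨s, -, hs, hsent⟩
  · exact ih h
  · dsimp only at hs hsent
    rw [r.sent_eq hj hs.symm] at hsent
    have heq := Option.some.inj hsent
    exact ⟨s + 1, congrArg Prod.fst heq, congrArg Prod.snd heq⟩

theorem Run.mem_inbox_of_delivered (hi : i ∉ F) {s τ : ℕ} (hj : j ∉ F) (hs : r.mover s = j)
    (hτ : r.mover τ = i) (hd : s ∈ r.delivered τ) :
    (j, ((r.sim (s + 1) j).round, (r.sim (s + 1) j).core)) ∈ (r.sim (τ + 1) i).inbox := by
  have hmem : (j, ((r.sim (s + 1) j).round, (r.sim (s + 1) j).core)) ∈ r.receives τ :=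
    ⟨s, hd, hs.symm, r.sent_eq hj hs _⟩
  rw [r.sim_move hi hτ]
  unfold RoundAlgorithm.simStep
  split_ifs <;> exact Or.inr hmem

/-- After stabilization every correct player moves at least once in `Δ` steps, as it sends messages
to itself. -/
theorem Run.exists_count_ge_le (hi : i ∉ F) {GST Δ τ₀ : ℕ} (hps : r.PartiallySynchronous GST Δ)
    (h₀ : GST ≤ τ₀) (hm₀ : r.mover τ₀ = i) (m : ℕ) :
    ∃ s, τ₀ ≤ s ∧ s ≤ τ₀ + Δ * m ∧ r.mover s = i ∧ m + 1 ≤ (r.sim (s + 1) i).count := by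
  induction m with
  | zero => exact ⟨τ₀, le_rfl, by simp, hm₀, by rw [r.count_move hi hm₀]; omega⟩
  | succ m ih =>
    obtain ⟨s, h1, h2, h3, h4⟩ := ih
    obtain ⟨τ, hτ, hm, hd⟩ := hps s i (by rwa [h3]) hi (r.sent_ne_none hi h3 i)
    have hlt := (r.in_transit τ s hd).1
    have hc : (r.sim (s + 1) i).count ≤ (r.sim τ i).count := r.count_mono hi hlt
    rw [max_eq_left (by omega)] at hτ
    refine ⟨τ, by omega, by rw [Nat.mul_succ]; omega, hm, ?_⟩
    rw [r.count_move hi hm]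
    omega

/-- The rounds simulated by a run are an execution of the round algorithm; under partial synchrony
no message between correct players is lost from some round on. -/
theorem Run.exists_rounds [Finite P] :
    ∃ x rcv, A.IsExecution F input x rcv ∧
      (∀ i ∉ F, ∀ τ, ∃ q, (r.sim τ i).core = x q i) ∧
      (∀ i ∉ F, ∀ q, ∃ τ, (r.sim τ i).core = x q i) ∧
      ∀ GST Δ, r.PartiallySynchronous GST Δ →
        ∃ R, ∀ q ≥ R, ∀ i ∉ F, ∀ j ∉ F, rcv q i j = some (x q j) := by
  classical
  have hadv (q : ℕ) (i : P) : ∃ τ, i ∉ F → r.mover τ = i ∧ (r.sim τ i).round = q ∧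
      (r.sim (τ + 1) i).round = q + 1 ∧ (r.sim (τ + 1) i).core = A.next q (r.sim τ i).core
        (roundMessages (r.sim (τ + 1) i).inbox q) := by
    by_cases hi : i ∈ F
    · exact ⟨0, fun h => absurd hi h⟩
    · obtain ⟨τ, h⟩ := r.exists_advance hi q
      exact ⟨τ, fun _ => h⟩
  choose e he using hadv
  have hx {i : P} (hi : i ∉ F) {τ q : ℕ} (h : (r.sim τ i).round = q) :
      (r.sim τ i).core = (r.sim (e q i) i).core :=
    r.core_eq_of_round_eq hi (h.trans (he q i hi).2.1.symm)
  have hauth : ∀ q, ∀ i ∉ F, ∀ j ∉ F, ∀ m,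
      roundMessages (r.sim (e q i + 1) i).inbox q j = some m → m = (r.sim (e q j) j).core := by
    intro q i hi j hj m hm
    unfold roundMessages at hm
    split_ifs at hm with h
    obtain ⟨s, hs, hc⟩ := r.mem_inbox hi hj h.choose_spec
    rw [← Option.some.inj hm, ← hc]
    exact hx hj hs
  refine ⟨fun q i => (r.sim (e q i) i).core, fun q i => roundMessages (r.sim (e q i + 1) i).inbox q,
    ⟨fun i hi => ?_, fun q i hi => ?_, hauth⟩, fun i hi τ => ⟨_, hx hi rfl⟩,
    fun i _ q => ⟨e q i, rfl⟩, fun GST Δ hps => ?_⟩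
  · rw [← hx hi (τ := 0) (q := 0) (by rw [r.sim_zero hi]), r.sim_zero hi]
  · rw [← (he q i hi).2.2.2]
    exact (hx hi (he q i hi).2.2.1).symm
  · have hstart (i : P) : ∃ τ, i ∉ F → GST ≤ τ ∧ r.mover τ = i := by
      by_cases hi : i ∈ F
      · exact ⟨0, fun h => absurd hi h⟩
      · obtain ⟨τ, h⟩ := r.fair i hi GST
        exact ⟨τ, fun _ => h⟩
    choose τ₀ hτ₀ using hstart
    obtain ⟨B, hB⟩ := (Set.finite_range τ₀).bddAbove
    -- With `q = p + 1`, the message for round `q` is sent by time `B + Δ * (p + 2)!` and arrives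
    -- within a further `Δ`. Round `q` is left no earlier than the move at time `(p + 3)! - 1`. The
    -- factor `p + 3` covers the coefficients once `p ≥ B + 2 * Δ`.
    refine ⟨B + 2 * Δ + 1, fun q hq i hi j hj => ?_⟩
    obtain ⟨p, rfl⟩ : ∃ p, q = p + 1 := ⟨q - 1, by omega⟩
    obtain ⟨hmj, hrj, hrj', -⟩ := he p j hj
    have hej : e p j ≤ B + Δ * (p + 2).factorial := by
      obtain ⟨s, -, hs, hms, hcs⟩ :=
        r.exists_count_ge_le hj hps (hτ₀ j hj).1 (hτ₀ j hj).2 (p + 2).factorial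
      have h1 : p + 1 ≤ (r.sim (s + 1) j).round := r.round_ge_of_count hj (by
        rw [show p + 1 + 1 = p + 2 from rfl]; omega)
      have h2 : e p j < s + 1 := by
        by_contra hle
        have := r.round_mono hj (not_lt.1 hle)
        simp only at this
        omega
      have := hB ⟨j, rfl⟩
      omega
    -- The move that leaves round `p` already sends the state of round `p + 1`.
    obtain ⟨τ, hτ, hmτ, hd⟩ := hps (e p j) i (by rwa [hmj]) hi (r.sent_ne_none hj hmj i)
    have hGST : GST ≤ B := (hτ₀ j hj).1.trans (hB ⟨j, rfl⟩)
    have hτ' : τ ≤ B + Δ * (p + 2).factorial + Δ := by omega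
    obtain ⟨hmi, hri, hri', -⟩ := he (p + 1) i hi
    have hei : (p + 3).factorial ≤ e (p + 1) i + 1 := by
      have h1 := (r.factorial_round_le hi (e (p + 1) i + 1)).1 (by omega)
      have h2 := r.count_le hi (e (p + 1) i + 1)
      rw [hri'] at h1
      exact h1.trans h2
    have hfac : (p + 3).factorial = (p + 3) * (p + 2).factorial := Nat.factorial_succ _
    have hpos : 1 ≤ (p + 2).factorial := Nat.factorial_pos _
    have hle : τ + 1 ≤ e (p + 1) i + 1 := by
      have : (B + 2 * Δ + 1) * (p + 2).factorial ≤ (p + 3) * (p + 2).factorial :=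
        Nat.mul_le_mul_right _ (by omega)
      nlinarith
    have hmem := r.inbox_mono hi hle (r.mem_inbox_of_delivered hi hj hmj hmτ hd)
    rw [hrj'] at hmem
    have hex : ∃ m, (j, (p + 1, m)) ∈ (r.sim (e (p + 1) i + 1) i).inbox := ⟨_, hmem⟩
    have hsome : roundMessages (r.sim (e (p + 1) i + 1) i).inbox (p + 1) j = some hex.choose :=
      dif_pos hex
    simp only
    rw [hsome, hauth (p + 1) i hi j hj _ hsome]

end Simulation

/-! ### Quorums and blocking sets -/

/-- More than two thirds of the players. -/
def IsQuorum {P : Type} (A : Set P) : Prop := 2 * Nat.card P < 3 * A.ncard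

/-- More than one third of the players. -/
def IsBlocking {P : Type} (A : Set P) : Prop := Nat.card P < 3 * A.ncard

section Quorums

variable {P : Type} [Finite P] {F A B : Set P}

theorem IsQuorum.mono (h : IsQuorum A) (hAB : A ⊆ B) : IsQuorum B :=
  h.trans_le (Nat.mul_le_mul_left 3 (Set.ncard_le_ncard hAB))

theorem IsBlocking.mono (h : IsBlocking A) (hAB : A ⊆ B) : IsBlocking B :=
  h.trans_le (Nat.mul_le_mul_left 3 (Set.ncard_le_ncard hAB))

theorem IsBlocking.exists_correct (h : IsBlocking A) (hF : 3 * F.ncard < Nat.card P) :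
    ∃ j ∈ A, j ∉ F := by
  by_contra! hsub
  have := Set.ncard_le_ncard (show A ⊆ F from hsub)
  unfold IsBlocking at h
  omega

theorem IsQuorum.isBlocking_diff (h : IsQuorum A) (hF : 3 * F.ncard < Nat.card P) :
    IsBlocking (A \ F) := by
  have := Set.ncard_le_ncard_sdiff_add_ncard A F
  unfold IsQuorum at h
  unfold IsBlocking
  omega

theorem IsQuorum.exists_correct (h : IsQuorum A) (hF : 3 * F.ncard < Nat.card P) :
    ∃ j ∈ A, j ∉ F := by
  obtain ⟨j, hj, hjF⟩ := (h.isBlocking_diff hF).exists_correct hF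
  exact ⟨j, hj.1, hjF⟩

/-- Two sets of more than two thirds overlap in more than one third, too many to be all faulty. -/
theorem IsQuorum.exists_correct_inter (hA : IsQuorum A) (hB : IsQuorum B)
    (hF : 3 * F.ncard < Nat.card P) : ∃ j ∈ A, j ∈ B ∧ j ∉ F := by
  have h : IsBlocking (A ∩ B) := by
    have h1 := Set.ncard_union_add_ncard_inter A B
    have h2 : (A ∪ B).ncard ≤ Nat.card P := by
      simpa using Set.ncard_le_ncard (Set.subset_univ (A ∪ B))
    unfold IsQuorum at hA hB
    unfold IsBlocking
    omega
  obtain ⟨j, hj, hjF⟩ := h.exists_correct hF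
  exact ⟨j, hj.1, hj.2, hjF⟩

theorem isQuorum_compl (hF : 3 * F.ncard < Nat.card P) : IsQuorum Fᶜ := by
  have := Set.ncard_add_ncard_compl F
  unfold IsQuorum
  omega

end Quorums

/-! ### Consensus in rounds -/

/-- The state of a player in the consensus algorithm. Votes, readiness, certificates and commits
are pairs of a phase and a value. -/
structure Core (α : Type u) : Type u where
  input : α
  approved : Set α
  proposal : Option α
  votes : Set (ℕ × α)
  ready : Set (ℕ × α)
  certs : Set (ℕ × α)
  commits : Set (ℕ × α)
  decision : Option α

/-- The players from whom a state with the property `p` was received. -/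
def heard {P : Type} {C : Type u} (rcv : P → Option C) (p : C → Prop) : Set P :=
  {j | ∃ m, rcv j = some m ∧ p m}

/-- If no messages between correct players are lost, the correct players are heard. -/
theorem subset_heard {P : Type} {C : Type u} {F : Set P} {x : ℕ → P → C}
    {rcv : ℕ → P → P → Option C} {R : ℕ} (hsync : ∀ q ≥ R, ∀ i ∉ F, ∀ j ∉ F, rcv q i j = some (x q j))
    {q : ℕ} (hq : R ≤ q) {i : P} (hi : i ∉ F) (p : C → Prop) :
    {j | j ∉ F ∧ p (x q j)} ⊆ heard (rcv q i) p :=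
  fun j hj => ⟨_, hsync q hq i hi j hj.1, hj.2⟩

/-- The leader of phase `k`, by rotation. -/
def IsLeader {P : Type} [Fintype P] (k : ℕ) (j : P) : Prop :=
  k % Fintype.card P = Fintype.equivFin P j

namespace Core

variable {P : Type} {α : Type u} (valid : α → Prop) (q : ℕ) (c : Core α)
  (rcv : P → Option (Core α))

def init (a : α) : Core α := ⟨a, {a}, none, ∅, ∅, ∅, ∅, none⟩

/-- A value gets approved if a correct player approves it, or if it is valid and the correct
players are known not to have another common input. -/
def nextApproved : Set α :=
  {v | v ∈ c.approved ∨ IsBlocking (heard rcv fun m => v ∈ m.approved) ∨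
    valid v ∧ ∀ w ≠ v, IsBlocking (heard rcv fun m => m.input ≠ w)}

/-- The blocking clause amplifies readiness, so that certificates spread. It is safe because a
blocking set contains a correct player, which traces readiness back to a quorum of votes. -/
def nextReady : Set (ℕ × α) :=
  {e | e ∈ c.ready ∨ IsQuorum (heard rcv fun m => e ∈ m.votes) ∨
    IsBlocking (heard rcv fun m => e ∈ m.ready)}

def nextCerts : Set (ℕ × α) :=
  {e | e ∈ c.certs ∨ IsQuorum (heard rcv fun m => e ∈ m.ready)}

/-- The values that a leader may propose in phase `k`: the value of the latest certificate, or, if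
there is none, any value approved by a quorum. -/
def MayPropose (k : ℕ) (v : α) : Prop :=
  (∃ h < k, (h, v) ∈ c.certs ∧ ∀ h' < k, ∀ w, (h', w) ∈ c.certs → h' ≤ h) ∨
    (∀ h' < k, ∀ w, (h', w) ∉ c.certs) ∧ IsQuorum (heard rcv fun m => v ∈ m.approved)

-- A stale proposal may persist when there is no candidate. Safety rests on the voting rule alone.
open Classical in
noncomputable def nextProposal : Option α :=
  if h : ∃ v k, q = 8 * k ∧ c.MayPropose rcv k v then some h.choose else c.proposal

/-- A player votes for the proposal of the leader if it approves it and all its earlier commits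
have the same value or are overruled by a certificate for the proposal that is at least as new. -/
def VotesFor [Fintype P] (k : ℕ) (v : α) : Prop :=
  (∃ j m, IsLeader k j ∧ rcv j = some m ∧ m.proposal = some v) ∧
    v ∈ c.nextApproved valid rcv ∧
    ∀ h w, (h, w) ∈ c.commits → w = v ∨ ∃ h', h ≤ h' ∧ h' < k ∧ (h', v) ∈ c.nextCerts rcv

def nextVotes [Fintype P] : Set (ℕ × α) :=
  {e | e ∈ c.votes ∨ q = 8 * e.1 + 1 ∧ c.VotesFor valid rcv e.1 e.2}

/-- Commits are confined to one round of their phase, so they precede, and thus bind, every vote of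
a later phase. Certificates may form at any time. -/
def nextCommits : Set (ℕ × α) :=
  {e | e ∈ c.commits ∨ q = 8 * e.1 + 3 ∧ e ∈ c.nextCerts rcv}

open Classical in
noncomputable def nextDecision : Option α :=
  if h : c.decision = none ∧ ∃ v k, IsQuorum (heard rcv fun m => (k, v) ∈ m.commits) then
    some h.2.choose else c.decision

noncomputable def next [Fintype P] : Core α where
  input := c.input
  approved := c.nextApproved valid rcv
  proposal := c.nextProposal q rcv
  votes := c.nextVotes valid q rcv
  ready := c.nextReady rcv
  certs := c.nextCerts rcv
  commits := c.nextCommits q rcv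
  decision := c.nextDecision rcv

end Core

/-- Consensus in rounds, with phases of eight rounds: in round `8 * k` the leader chooses its
proposal, in round `8 * k + 1` the players vote, by the end of round `8 * k + 3` the votes have been
certified and are committed to, and a quorum of commits decides. -/
noncomputable abbrev consensusRounds (P : Type) [Fintype P] {α : Type u} (valid : α → Prop) :
    RoundAlgorithm P α where
  State := Core α
  init := Core.init
  next q c rcv := c.next valid q rcv
  output := Core.decision

section Consensus

variable {P : Type} [Fintype P] {α : Type u} {valid : α → Prop} {F : Set P} {input : P → α}
  {x : ℕ → P → Core α} {rcv : ℕ → P → P → Option (Core α)}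

theorem exists_isLeader (i : P) (K : ℕ) : ∃ k ≥ K, IsLeader k i := by
  refine ⟨K * Fintype.card P + Fintype.equivFin P i, ?_, ?_⟩
  · have : 0 < Fintype.card P := Fintype.card_pos_iff.2 ⟨i⟩
    nlinarith
  · rw [IsLeader, Nat.mul_add_mod_of_lt (Fintype.equivFin P i).2]

theorem IsLeader.eq {k : ℕ} {i j : P} (hi : IsLeader k i) (hj : IsLeader k j) : i = j :=
  (Fintype.equivFin P).injective (Fin.ext (hi.symm.trans hj))

/-- The phase has one leader, from which one state with one proposal is received. -/
theorem Core.VotesFor.unique {c : Core α} {g : P → Option (Core α)} {k : ℕ} {v w : α}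
    (hv : c.VotesFor valid g k v) (hw : c.VotesFor valid g k w) : v = w := by
  obtain ⟨⟨j, m, hj, hm, hp⟩, -⟩ := hv
  obtain ⟨⟨j', m', hj', hm', hp'⟩, -⟩ := hw
  cases hj.eq hj'
  cases hm.symm.trans hm'
  exact Option.some.inj (hp.symm.trans hp')

/-! ### Invariants and safety of the consensus rounds. -/

namespace RoundAlgorithm.IsExecution

variable (e : (consensusRounds P valid).IsExecution F input x rcv) (hF : 3 * F.ncard < Nat.card P)

include e

theorem core_zero {i : P} (hi : i ∉ F) : x 0 i = Core.init (input i) := e.zero i hi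

theorem core_succ (q : ℕ) {i : P} (hi : i ∉ F) :
    x (q + 1) i = (x q i).next valid q (rcv q i) := e.succ q i hi

theorem of_mem_heard {q : ℕ} {i j : P} {p : Core α → Prop} (hi : i ∉ F) (hj : j ∉ F)
    (h : j ∈ heard (rcv q i) p) : p (x q j) := by
  obtain ⟨m, hm, hp⟩ := h
  exact e.authentic q i hi j hj m hm ▸ hp

theorem input_eq (q : ℕ) {i : P} (hi : i ∉ F) : (x q i).input = input i := by
  induction q with
  | zero => rw [e.core_zero hi]; rfl
  | succ q ih => rw [e.core_succ q hi]; exact ih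

theorem approved_mono {i : P} (hi : i ∉ F) : Monotone fun q => (x q i).approved :=
  monotone_nat_of_le_succ fun q => by rw [e.core_succ q hi]; exact fun v hv => Or.inl hv

theorem ready_mono {i : P} (hi : i ∉ F) : Monotone fun q => (x q i).ready :=
  monotone_nat_of_le_succ fun q => by rw [e.core_succ q hi]; exact fun v hv => Or.inl hv

theorem certs_mono {i : P} (hi : i ∉ F) : Monotone fun q => (x q i).certs :=
  monotone_nat_of_le_succ fun q => by rw [e.core_succ q hi]; exact fun v hv => Or.inl hv

theorem commits_mono {i : P} (hi : i ∉ F) : Monotone fun q => (x q i).commits :=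
  monotone_nat_of_le_succ fun q => by rw [e.core_succ q hi]; exact fun v hv => Or.inl hv

theorem of_mem_votes {q k : ℕ} {v : α} {i : P} (hi : i ∉ F) (h : (k, v) ∈ (x q i).votes) :
    8 * k + 2 ≤ q ∧ (x (8 * k + 1) i).VotesFor valid (rcv (8 * k + 1) i) k v := by
  induction q with
  | zero => rw [e.core_zero hi] at h; exact absurd h (Set.notMem_empty _)
  | succ q ih =>
    rw [e.core_succ q hi] at h
    rcases h with h | ⟨rfl, h⟩
    · exact ⟨(ih h).1.trans (Nat.le_succ q), (ih h).2⟩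
    · exact ⟨le_rfl, h⟩

theorem of_mem_commits {q k : ℕ} {v : α} {i : P} (hi : i ∉ F) (h : (k, v) ∈ (x q i).commits) :
    8 * k + 4 ≤ q ∧ (k, v) ∈ (x (8 * k + 4) i).certs ∧ (k, v) ∈ (x (8 * k + 4) i).commits := by
  induction q with
  | zero => rw [e.core_zero hi] at h; exact absurd h (Set.notMem_empty _)
  | succ q ih =>
    have h0 := h
    rw [e.core_succ q hi] at h
    rcases h with h | ⟨rfl, h⟩
    · exact ⟨(ih h).1.trans (Nat.le_succ q), (ih h).2⟩
    · refine ⟨le_rfl, ?_, h0⟩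
      rw [e.core_succ _ hi]
      exact h

include hF

/-- Correct players approve only valid values, and only the common input if there is one. -/
theorem approved_sound (hvalid : ∀ i ∉ F, valid (input i)) {q : ℕ} {i : P} (hi : i ∉ F) {v : α}
    (h : v ∈ (x q i).approved) : valid v ∧ ∀ a, (∀ j ∉ F, input j = a) → v = a := by
  induction q generalizing i with
  | zero =>
    rw [e.core_zero hi] at h
    cases Set.mem_singleton_iff.1 h
    exact ⟨hvalid i hi, fun a ha => ha i hi⟩
  | succ q ih =>
    rw [e.core_succ q hi] at h
    rcases h with h | h | ⟨hv, h⟩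
    · exact ih hi h
    · obtain ⟨j, hj, hjF⟩ := h.exists_correct hF
      exact ih hjF (e.of_mem_heard hi hjF hj)
    · refine ⟨hv, fun a ha => ?_⟩
      by_contra hne
      obtain ⟨j, hj, hjF⟩ := (h a (Ne.symm hne)).exists_correct hF
      exact e.of_mem_heard hi hjF hj ((e.input_eq q hjF).trans (ha j hjF))

/-- A ready correct player is backed by the votes of a quorum. -/
theorem quorum_of_mem_ready {q k : ℕ} {v : α} {i : P} (hi : i ∉ F)
    (h : (k, v) ∈ (x q i).ready) :
    8 * k + 2 ≤ q ∧ ∃ A : Set P, IsQuorum A ∧ ∀ j ∈ A, j ∉ F →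
      (x (8 * k + 1) j).VotesFor valid (rcv (8 * k + 1) j) k v := by
  induction q generalizing i with
  | zero => rw [e.core_zero hi] at h; exact absurd h (Set.notMem_empty _)
  | succ q ih =>
    rw [e.core_succ q hi] at h
    rcases h with h | h | h
    · exact ⟨(ih hi h).1.trans (Nat.le_succ q), (ih hi h).2⟩
    · obtain ⟨j, hj, hjF⟩ := h.exists_correct hF
      exact ⟨(e.of_mem_votes hjF (e.of_mem_heard hi hjF hj)).1.trans (Nat.le_succ q), _, h,
        fun j hj hjF => (e.of_mem_votes hjF (e.of_mem_heard hi hjF hj)).2⟩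
    · obtain ⟨j, hj, hjF⟩ := h.exists_correct hF
      have := ih hjF (e.of_mem_heard hi hjF hj)
      exact ⟨this.1.trans (Nat.le_succ q), this.2⟩

/-- A certificate of a correct player is backed by a blocking set of ready correct players. -/
theorem blocking_of_mem_certs {q : ℕ} {a : ℕ × α} {i : P} (hi : i ∉ F)
    (h : a ∈ (x q i).certs) : IsBlocking {j | j ∉ F ∧ a ∈ (x q j).ready} := by
  induction q with
  | zero => rw [e.core_zero hi] at h; exact absurd h (Set.notMem_empty _)
  | succ q ih =>
    rw [e.core_succ q hi] at h
    rcases h with h | h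
    · exact (ih h).mono fun j hj => ⟨hj.1, e.ready_mono hj.1 (Nat.le_succ q) hj.2⟩
    · exact (h.isBlocking_diff hF).mono fun j hj =>
        ⟨hj.2, e.ready_mono hj.2 (Nat.le_succ q) (e.of_mem_heard hi hj.2 hj.1)⟩

theorem quorum_of_mem_certs {q k : ℕ} {v : α} {i : P} (hi : i ∉ F)
    (h : (k, v) ∈ (x q i).certs) :
    8 * k + 2 ≤ q ∧ ∃ A : Set P, IsQuorum A ∧ ∀ j ∈ A, j ∉ F →
      (x (8 * k + 1) j).VotesFor valid (rcv (8 * k + 1) j) k v := by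
  obtain ⟨j, hj, hjF⟩ := (e.blocking_of_mem_certs hF hi h).exists_correct hF
  exact e.quorum_of_mem_ready hF hjF hj.2

/-- Once a quorum has committed to a value, no other value is certified in the same or any later
phase. -/
theorem cert_eq_of_quorum_commits {k : ℕ} {v : α} {A : Set P} (hA : IsQuorum A)
    (hAc : ∀ j ∈ A, j ∉ F → ∃ q, (k, v) ∈ (x q j).commits) {k' q : ℕ} {w : α} {i : P}
    (hk : k ≤ k') (hi : i ∉ F) (h : (k', w) ∈ (x q i).certs) : w = v := by
  induction k' using Nat.strong_induction_on generalizing q i with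
  | _ k' ih =>
    obtain ⟨-, B, hB, hBv⟩ := e.quorum_of_mem_certs hF hi h
    rcases hk.eq_or_lt with rfl | hlt
    · obtain ⟨c, hc, hcF⟩ := hA.exists_correct hF
      obtain ⟨q', hq'⟩ := hAc c hc hcF
      obtain ⟨-, B', hB', hBv'⟩ := e.quorum_of_mem_certs hF hcF (e.of_mem_commits hcF hq').2.1
      obtain ⟨j, hj, hj', hjF⟩ := hB.exists_correct_inter hB' hF
      exact (hBv j hj hjF).unique (hBv' j hj' hjF)
    -- Later phase: a correct player both committed to `v` and voted for `w`. If `w` differs from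
    -- `v`, its vote relied on a certificate for `w` from a phase in `[k, k')`, to which induction
    -- applies.
    · obtain ⟨j, hj, hj', hjF⟩ := hA.exists_correct_inter hB hF
      obtain ⟨q', hq'⟩ := hAc j hj hjF
      have hcom := e.commits_mono hjF (show 8 * k + 4 ≤ 8 * k' + 1 by omega)
        (e.of_mem_commits hjF hq').2.2
      rcases (hBv j hj' hjF).2.2 k v hcom with heq | ⟨h', h1, h2, h3⟩
      · exact heq.symm
      · refine ih h' h2 (q := 8 * k' + 2) h1 hjF ?_
        rw [e.core_succ _ hjF]
        exact h3

omit hF in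
/-- A decision is backed by the commits of a quorum. -/
theorem quorum_of_decision {q : ℕ} {v : α} {i : P} (hi : i ∉ F)
    (h : (x q i).decision = some v) :
    ∃ k, ∃ A : Set P, IsQuorum A ∧ ∀ j ∈ A, j ∉ F → ∃ q, (k, v) ∈ (x q j).commits := by
  induction q with
  | zero => rw [e.core_zero hi] at h; cases h
  | succ q ih =>
    rw [e.core_succ q hi] at h
    simp only [Core.next, Core.nextDecision] at h
    split_ifs at h with hd
    · obtain ⟨k, hk⟩ := hd.2.choose_spec
      rw [Option.some.inj h] at hk
      exact ⟨k, _, hk, fun j hj hjF => ⟨q, e.of_mem_heard hi hjF hj⟩⟩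
    · exact ih h

theorem exists_cert_of_quorum_commits {k : ℕ} {v : α} {A : Set P} (hA : IsQuorum A)
    (hAc : ∀ j ∈ A, j ∉ F → ∃ q, (k, v) ∈ (x q j).commits) :
    ∃ j ∉ F, ∃ q, (k, v) ∈ (x q j).certs := by
  obtain ⟨j, hj, hjF⟩ := hA.exists_correct hF
  obtain ⟨q, hq⟩ := hAc j hj hjF
  exact ⟨j, hjF, _, (e.of_mem_commits hjF hq).2.1⟩

/-- The commits behind the decision of the earlier phase lock its value, and the other decision
comes with a certificate from that phase or a later one. -/
theorem agreement {q q' : ℕ} {v w : α} {i j : P} (hi : i ∉ F) (hj : j ∉ F)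
    (hv : (x q i).decision = some v) (hw : (x q' j).decision = some w) : v = w := by
  obtain ⟨k, A, hA, hAc⟩ := e.quorum_of_decision hi hv
  obtain ⟨k', B, hB, hBc⟩ := e.quorum_of_decision hj hw
  obtain ⟨a, ha, p, hp⟩ := e.exists_cert_of_quorum_commits hF hA hAc
  obtain ⟨b, hb, p', hp'⟩ := e.exists_cert_of_quorum_commits hF hB hBc
  rcases le_total k k' with h | h
  · exact (e.cert_eq_of_quorum_commits hF hA hAc h hb hp').symm
  · exact e.cert_eq_of_quorum_commits hF hB hBc h ha hp

/-- The value of a certificate has been approved by a blocking set of correct players. -/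
theorem blocking_approved_of_cert {q k : ℕ} {v : α} {i : P} (hi : i ∉ F)
    (h : (k, v) ∈ (x q i).certs) : IsBlocking {j | j ∉ F ∧ v ∈ (x (8 * k + 2) j).approved} := by
  obtain ⟨-, A, hA, hAv⟩ := e.quorum_of_mem_certs hF hi h
  refine (hA.isBlocking_diff hF).mono fun j hj => ⟨hj.2, ?_⟩
  rw [e.core_succ _ hj.2]
  exact (hAv j hj.1 hj.2).2.1

/-- A decision goes back through commits, a certificate and votes to approval by a correct player.
-/
theorem decision_sound (hvalid : ∀ i ∉ F, valid (input i)) {q : ℕ} {i : P} (hi : i ∉ F) {v : α}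
    (h : (x q i).decision = some v) : valid v ∧ ∀ a, (∀ j ∉ F, input j = a) → v = a := by
  obtain ⟨k, A, hA, hAc⟩ := e.quorum_of_decision hi h
  obtain ⟨a, ha, p, hp⟩ := e.exists_cert_of_quorum_commits hF hA hAc
  obtain ⟨j, hj, hjF⟩ := (e.blocking_approved_of_cert hF ha hp).exists_correct hF
  exact e.approved_sound hF hvalid hjF hj.2

/-! ### Termination of the consensus rounds after stabilization. -/

variable {R : ℕ} (hsync : ∀ q ≥ R, ∀ i ∉ F, ∀ j ∉ F, rcv q i j = some (x q j))

include hsync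

omit hF in
theorem approved_of_blocking {q : ℕ} (hq : R ≤ q) {v : α}
    (h : IsBlocking {j | j ∉ F ∧ v ∈ (x q j).approved}) {i : P} (hi : i ∉ F) :
    v ∈ (x (q + 1) i).approved := by
  rw [e.core_succ q hi]
  exact Or.inr (Or.inl (h.mono (subset_heard hsync hq hi fun m => v ∈ m.approved)))

/-- Certificates spread within two rounds. -/
theorem cert_relay {q : ℕ} (hq : R ≤ q) {a : ℕ × α} {i j : P} (hi : i ∉ F) (hj : j ∉ F)
    (h : a ∈ (x q i).certs) : a ∈ (x (q + 2) j).certs := by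
  have hready : ∀ l ∉ F, a ∈ (x (q + 1) l).ready := fun l hl => by
    rw [e.core_succ q hl]
    exact Or.inr (Or.inr ((e.blocking_of_mem_certs hF hi h).mono
      (subset_heard hsync hq hl fun m => a ∈ m.ready)))
  rw [e.core_succ (q + 1) hj]
  exact Or.inr ((isQuorum_compl hF).mono fun l hl =>
    subset_heard hsync (by omega) hj (fun m => a ∈ m.ready) ⟨hl, hready l hl⟩)

/-- After stabilization some value is approved by all correct players. -/
theorem exists_approved (hvalid : ∀ i ∉ F, valid (input i)) {q : ℕ} (hq : R < q) :
    ∃ v, ∀ i ∉ F, v ∈ (x q i).approved := by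
  obtain ⟨q, rfl⟩ : ∃ p, q = p + 1 := ⟨q - 1, by omega⟩
  have hown : ∀ p, ∀ i ∉ F, input i ∈ (x p i).approved := fun p i hi => by
    refine e.approved_mono hi (Nat.zero_le p) ?_
    simp only [e.core_zero hi]
    exact Set.mem_singleton _
  by_cases h : ∃ v, IsBlocking {j | j ∉ F ∧ input j = v}
  · obtain ⟨v, hv⟩ := h
    refine ⟨v, fun i hi => e.approved_of_blocking hsync (by omega) (hv.mono fun j hj => ?_) hi⟩
    exact ⟨hj.1, hj.2 ▸ hown q j hj.1⟩
  -- More than two thirds are correct and at most one third are correct with input `w`, so a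
  -- blocking set of correct players has an input other than `w`. Any valid value is then approved.
  · push Not at h
    obtain ⟨j₀, hj₀⟩ : ∃ j, j ∉ F := by
      obtain ⟨j, -, hj⟩ := (isQuorum_compl hF).exists_correct hF
      exact ⟨j, hj⟩
    refine ⟨input j₀, fun i hi => ?_⟩
    rw [e.core_succ q hi]
    refine Or.inr (Or.inr ⟨hvalid j₀ hj₀, fun w _ => ?_⟩)
    have hblock : IsBlocking {j | j ∉ F ∧ (x q j).input ≠ w} := by
      have h1 := h w
      have h2 := isQuorum_compl hF
      have h3 : Fᶜ ⊆ {j | j ∉ F ∧ input j = w} ∪ {j | j ∉ F ∧ (x q j).input ≠ w} := by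
        intro j hj
        by_cases hw : input j = w
        · exact Or.inl ⟨hj, hw⟩
        · exact Or.inr ⟨hj, by rwa [e.input_eq q hj]⟩
      have h4 := (Set.ncard_le_ncard h3).trans (Set.ncard_union_le _ _)
      unfold IsBlocking at h1 ⊢
      unfold IsQuorum at h2
      omega
    exact hblock.mono (subset_heard hsync (by omega) hi fun m => m.input ≠ w)

/-- A correct leader after stabilization proposes a value for which all correct players vote. -/
theorem exists_common_vote (hvalid : ∀ i ∉ F, valid (input i)) {k : ℕ} (hk : R + 4 < 8 * k) {l : P}
    (hl : l ∉ F) (hlead : IsLeader k l) : ∃ v, ∀ i ∉ F, (k, v) ∈ (x (8 * k + 2) i).votes := by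
  classical
  -- Commits of earlier phases are certified by round `8 * k - 4`, which is after stabilization; the
  -- two-round relay brings them to the leader before it proposes.
  have hcommit {i : P} (hi : i ∉ F) {h : ℕ} {w : α} (hc : (h, w) ∈ (x (8 * k + 1) i).commits) :
      h < k ∧ (h, w) ∈ (x (8 * k) l).certs := by
    obtain ⟨h1, h2, -⟩ := e.of_mem_commits hi hc
    have h3 : (h, w) ∈ (x (8 * k - 4) i).certs := e.certs_mono hi (by omega) h2
    exact ⟨by omega, e.certs_mono hl (by omega) (e.cert_relay hF hsync (by omega) hi hl h3)⟩
  have hex : ∃ v k', 8 * k = 8 * k' ∧ (x (8 * k) l).MayPropose (rcv (8 * k) l) k' v := by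
    by_cases hc : ∃ h, h < k ∧ ∃ w, (h, w) ∈ (x (8 * k) l).certs
    · obtain ⟨h₀, hh₀, w₀, hw₀⟩ := hc
      -- The candidate is the value of the leader's latest certificate.
      obtain ⟨hlt, v, hv⟩ := Nat.findGreatest_spec
        (P := fun h => h < k ∧ ∃ w, (h, w) ∈ (x (8 * k) l).certs) hh₀.le ⟨hh₀, w₀, hw₀⟩
      exact ⟨v, k, rfl, Or.inl ⟨_, hlt, hv, fun h' hh' w hw =>
        Nat.le_findGreatest hh'.le ⟨hh', w, hw⟩⟩⟩
    · push Not at hc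
      obtain ⟨v, hv⟩ := e.exists_approved hF hsync hvalid (show R < 8 * k by omega)
      exact ⟨v, k, rfl, Or.inr ⟨hc, (isQuorum_compl hF).mono fun j hj =>
        subset_heard hsync (by omega) hl (fun m => v ∈ m.approved) ⟨hj, hv j hj⟩⟩⟩
  obtain ⟨v, hprop, hmay⟩ : ∃ v, (x (8 * k + 1) l).proposal = some v ∧
      (x (8 * k) l).MayPropose (rcv (8 * k) l) k v := by
    obtain ⟨k', hk', hspec⟩ := hex.choose_spec
    obtain rfl : k = k' := by omega
    refine ⟨hex.choose, ?_, hspec⟩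
    rw [e.core_succ _ hl]
    exact dif_pos hex
  refine ⟨v, fun i hi => ?_⟩
  rw [e.core_succ _ hi]
  refine Or.inr ⟨rfl, ⟨l, _, hlead, hsync _ (by omega) i hi l hl, hprop⟩, ?_, fun h w hc => ?_⟩
  · refine Or.inl ?_
    refine e.approved_of_blocking hsync (by omega) ?_ hi
    rcases hmay with ⟨h, hh, hcert, -⟩ | ⟨-, hq⟩
    · exact (e.blocking_approved_of_cert hF hl hcert).mono fun j hj =>
        ⟨hj.1, e.approved_mono hj.1 (by omega) hj.2⟩
    · exact (hq.isBlocking_diff hF).mono fun j hj => ⟨hj.2, e.of_mem_heard hl hj.2 hj.1⟩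
  · obtain ⟨hlt, hcert'⟩ := hcommit hi hc
    rcases hmay with ⟨h', hh', hcert, hmax⟩ | ⟨hno, -⟩
    -- The leader knows the certificate behind the commit, so its latest one is at least as new. The
    -- relay brings that one to the voter in round `8 * k + 2`, which is where `nextCerts` looks.
    · refine Or.inr ⟨h', hmax h hlt w hcert', hh', ?_⟩
      have := e.cert_relay hF hsync (by omega) hl hi hcert
      rwa [e.core_succ _ hi] at this
    · exact absurd hcert' (hno h hlt w)

/-- A late phase led by `i` itself suffices: the common votes become readiness, then commits, then a
decision, one round each. -/
theorem exists_decision (hvalid : ∀ i ∉ F, valid (input i)) {i : P} (hi : i ∉ F) :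
    ∃ q v, (x q i).decision = some v := by
  obtain ⟨k, hk, hlead⟩ := exists_isLeader i (R + 5)
  obtain ⟨v, hvote⟩ := e.exists_common_vote hF hsync hvalid (by omega) hi hlead
  have hready : ∀ j ∉ F, (k, v) ∈ (x (8 * k + 3) j).ready := fun j hj => by
    rw [e.core_succ _ hj]
    exact Or.inr (Or.inl ((isQuorum_compl hF).mono fun l hl =>
      subset_heard hsync (by omega) hj (fun m => (k, v) ∈ m.votes) ⟨hl, hvote l hl⟩))
  have hcommit : ∀ j ∉ F, (k, v) ∈ (x (8 * k + 4) j).commits := fun j hj => by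
    rw [e.core_succ _ hj]
    exact Or.inr ⟨rfl, Or.inr ((isQuorum_compl hF).mono fun l hl =>
      subset_heard hsync (by omega) hj (fun m => (k, v) ∈ m.ready) ⟨hl, hready l hl⟩)⟩
  have hex : ∃ v k', IsQuorum (heard (rcv (8 * k + 4) i) fun m => (k', v) ∈ m.commits) :=
    ⟨v, k, (isQuorum_compl hF).mono fun l hl =>
      subset_heard hsync (by omega) hi (fun m => (k, v) ∈ m.commits) ⟨hl, hcommit l hl⟩⟩
  rcases hd : (x (8 * k + 4) i).decision with _ | w
  · have hnew : (x (8 * k + 4) i).decision = none ∧ ∃ v k',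
        IsQuorum (heard (rcv (8 * k + 4) i) fun m => (k', v) ∈ m.commits) := ⟨hd, hex⟩
    refine ⟨8 * k + 5, hnew.2.choose, ?_⟩
    rw [e.core_succ _ hi]
    exact dif_pos hnew
  · exact ⟨_, w, hd⟩

end RoundAlgorithm.IsExecution

end Consensus

/-- The simulated round algorithm solves consensus with less than a third of the players faulty. -/
theorem solvesConsensus_consensusRounds {P : Type} [Fintype P] {α : Type u} (valid : α → Prop)
    {F : Set P} (hF : 3 * F.ncard < Nat.card P) :
    SolvesConsensus (consensusRounds P valid).toProtocol valid F := by
  intro input hvalid r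
  obtain ⟨x, rcv, e, hcore, hround, hsync⟩ := r.exists_rounds
  have hdec {i : P} {τ : ℕ} {v : α} (hi : i ∉ F) (h : r.Decides i τ v) :
      ∃ q, (x q i).decision = some v := by
    obtain ⟨q, hq⟩ := hcore i hi τ
    exact ⟨q, hq ▸ h⟩
  refine ⟨fun i hi j hj τ τ' v w hv hw => ?_, fun i hi τ v hv => ?_, fun GST Δ hps i hi => ?_⟩
  · obtain ⟨q, hq⟩ := hdec hi hv
    obtain ⟨q', hq'⟩ := hdec hj hw
    exact e.agreement hF hi hj hq hq'
  · obtain ⟨q, hq⟩ := hdec hi hv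
    exact e.decision_sound hF hvalid hi hq
  · obtain ⟨R, hR⟩ := hsync GST Δ hps
    obtain ⟨q, v, hv⟩ := e.exists_decision hF hR hvalid hi
    obtain ⟨τ, hτ⟩ := hround i hi q
    refine ⟨τ, v, ?_⟩
    rw [← hτ] at hv
    exact hv

end Snare

theorem mainTheorem8 (f : ℕ) {V : Type v} {α : Type u} (valid : α → Prop) :
    ∃ W : (E : Finset (Snare.Player f)) → Snare.Protocol (Snare.Residual E) α,
      ∀ (S : Snare.Setup f V) (s : Snare.State f V) (a : ℕ),
        Snare.Reachable S s → (Snare.branches S s).ncard = a → 2 ≤ a →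
        3 * f + 1 ≤ (Snare.detected S s).card ∧
        Snare.detected S s ⊆ S.coalition ∧
        ∀ E ⊆ Snare.detected S s, 3 * f + 1 ≤ E.card →
          (E.card = 3 * f + 1 → Fintype.card (Snare.Residual E) = 2 * f) ∧
          (S.coalition.card ≤ (11 * f + 2) / 3 → (S.byz.card : ℝ) < 2 * (f : ℝ) / 3 →
            ((S.coalition \ E).card : ℝ) < (Fintype.card (Snare.Residual E) : ℝ) / 3 ∧
            Snare.SolvesConsensus (W E) valid {p : Snare.Residual E | p.1 ∈ S.coalition}) := by
  refine ⟨fun E => (Snare.consensusRounds (Snare.Residual E) valid).toProtocol, ?_⟩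
  rintro S s _ hs rfl ha
  refine ⟨hs.card_detected ha, hs.detected_subset_coalition, fun E hE hcard => ⟨fun h => ?_,
    fun hC _ => ?_⟩⟩
  · rw [Snare.card_residual, h]
    omega
  · have hlt := Snare.three_mul_card_sdiff_lt (hE.trans hs.detected_subset_coalition) hcard hC
    constructor
    · rw [lt_div_iff₀ (by norm_num), mul_comm]
      exact_mod_cast hlt
    · apply Snare.solvesConsensus_consensusRounds
      refine lt_of_le_of_lt (Nat.mul_le_mul_left 3 ?_) (hlt.trans_eq Nat.card_eq_fintype_card.symm)
      -- The faulty residual players are counted inside `Player f`, where they lie in `S.coalition \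
      -- E`.
      rw [← Set.ncard_coe_finset, ← Set.ncard_image_of_injective _ Subtype.val_injective]
      refine Set.ncard_le_ncard ?_
      rintro _ ⟨p, hp, rfl⟩
      exact Finset.mem_coe.2 (Finset.mem_sdiff.2 ⟨hp, p.2⟩)
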